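/- Theorem (interpolation error). Let $d\ge 1$, let $Q$ be a quadratic form on $\mathbb R^d$ (possibly indefinite and/or degenerate), and let $X\subset\mathbb R^d$ be a finite set in spacelike position with respect to $Q$, i.e. $Q(x-y)>0$ for all distinct $x,y\in X$. Let $\mathrm{CH}(X)$ be the convex hull of $X$ and let $\mathcal P(X)$ be the set of all triangulations (geometric simplicial complexes) of $\mathrm{CH}(X)$ whose set of vertices is exactly $X$. A $Q$-ball is a region $\{x : Q(x)\le \varphi(x)+D\}$ with $\varphi$ a linear functional and $D\in\mathbb R$. A $Q$-Delaunay triangulation of $X$ is a $T\in\mathcal P(X)$ satisfying the empty $Q$-ball condition: each simplex of $T$ is contained in a $Q$-ball which has the vertices of the simplex on its boundary and no point of $X$ in its interior, and this $Q$-ball is unique for each $d$-dimensional simplex. For $T\in\mathcal P(X)$ and $f:\mathbb R^d\to\mathbb R$ let $\hat f_T$ be the function on $\mathrm{CH}(X)$ that is affine on each simplex of $T$ and equal to $f$ on $X$, and for $1\le p\le\infty$ let $$\mathcal Q(T,f,p)=\|f-\hat f_T\|_{L^p(\mathrm{CH}(X),\mu)},$$ where $\mu$ is a fixed positive constant multiple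 of Lebesgue measure (for instance Lebesgue measure itself, or the volume $|\det A|^{1/2}\,dx$ of $Q(x)=x^TAx$ when $Q$ is non-degenerate). Then a $Q$-Delaunay triangulation of $X$ exists, and every $Q$-Delaunay triangulation $\mathrm{Del}_Q(X)$ of $X$ minimizes the interpolation error of the function $Q(\cdot)$: $$\mathcal Q(\mathrm{Del}_Q(X),Q(\cdot),p)=\min_{T\in\mathcal P(X)}\mathcal Q(T,Q(\cdot),p)\qquad\text{for every } 1\le p\le\infty.$$ -/

import Mathlib

open MeasureTheory
open scoped ENNReal

/-- A finite set `X` is in spacelike position with respect to the quadratic form `Q` if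
`Q (x - y) > 0` for all distinct `x, y ∈ X`. -/
def SpacelikePosition {d : ℕ} (Q : QuadraticForm ℝ (EuclideanSpace ℝ (Fin d)))
    (X : Finset (EuclideanSpace ℝ (Fin d))) : Prop :=
  ∀ x ∈ X, ∀ y ∈ X, x ≠ y → 0 < Q (x - y)

/-- A `Q`-ball is a region `{x | Q x ≤ φ x + D}` with `φ` a linear functional and `D` a real
constant. -/
def IsQBall {d : ℕ} (Q : QuadraticForm ℝ (EuclideanSpace ℝ (Fin d)))
    (B : Set (EuclideanSpace ℝ (Fin d))) : Prop :=
  ∃ (φ : EuclideanSpace ℝ (Fin d) →ₗ[ℝ] ℝ) (D : ℝ), B = {x | Q x ≤ φ x + D}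

/-- `B` is an empty `Q`-ball circumscribed about the simplex with vertex set `s`: the simplex is
contained in `B`, its vertices lie on the `Q`-sphere bounding `B`, and no point of `X` lies in the
interior of `B`. -/
structure IsEmptyCircumscribedQBall {d : ℕ} (Q : QuadraticForm ℝ (EuclideanSpace ℝ (Fin d)))
    (X s : Finset (EuclideanSpace ℝ (Fin d))) (B : Set (EuclideanSpace ℝ (Fin d))) : Prop where
  isQBall : IsQBall Q B
  simplex_subset : convexHull ℝ (s : Set (EuclideanSpace ℝ (Fin d))) ⊆ B
  vertices_on_sphere : ∀ v ∈ s, v ∈ frontier B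
  empty : ∀ x ∈ X, x ∉ interior B

/-- `T` is a triangulation of the convex hull of `X` whose set of vertices is exactly `X`. -/
structure IsTriangulationOf {d : ℕ} (X : Finset (EuclideanSpace ℝ (Fin d)))
    (T : Geometry.SimplicialComplex ℝ (EuclideanSpace ℝ (Fin d))) : Prop where
  vertices_eq : T.vertices = (X : Set (EuclideanSpace ℝ (Fin d)))
  space_eq : T.space = convexHull ℝ (X : Set (EuclideanSpace ℝ (Fin d)))

/-- `T` is a `Q`-Delaunay triangulation of `X`: a triangulation of the convex hull of `X` with
vertex set `X` satisfying the empty `Q`-ball condition. Each simplex is inscribed in an empty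
`Q`-ball, and this `Q`-ball is unique for simplices of full dimension `d` (a simplex of lower
dimension may be inscribed in several `Q`-balls). -/
structure IsQDelaunayTriangulation {d : ℕ} (Q : QuadraticForm ℝ (EuclideanSpace ℝ (Fin d)))
    (X : Finset (EuclideanSpace ℝ (Fin d)))
    (T : Geometry.SimplicialComplex ℝ (EuclideanSpace ℝ (Fin d))) : Prop where
  isTriangulationOf : IsTriangulationOf X T
  inscribed : ∀ s ∈ T.faces, ∃ B, IsEmptyCircumscribedQBall Q X s B
  inscribed_unique : ∀ s ∈ T.faces, s.card = d + 1 → ∃! B, IsEmptyCircumscribedQBall Q X s B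

/-- `w` restricts to barycentric coordinates of the point `y` in the simplex with vertex
set `s`. -/
structure IsBarycentric {d : ℕ} (s : Finset (EuclideanSpace ℝ (Fin d)))
    (w : EuclideanSpace ℝ (Fin d) → ℝ) (y : EuclideanSpace ℝ (Fin d)) : Prop where
  nonneg : ∀ v ∈ s, 0 ≤ w v
  sum_eq_one : ∑ v ∈ s, w v = 1
  sum_smul : ∑ v ∈ s, w v • v = y

open Classical in
/-- The piecewise linear interpolation of `f` based on the triangulation `T`: at a point `y` with
barycentric coordinates `w` in a simplex `s` of `T`, its value is `∑ v ∈ s, w v * f v` (this does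
not depend on the choice of `s`, see `linearInterpolation_eq`); it is `0` outside of the space
of `T`. -/
noncomputable def linearInterpolation {d : ℕ}
    (T : Geometry.SimplicialComplex ℝ (EuclideanSpace ℝ (Fin d)))
    (f : EuclideanSpace ℝ (Fin d) → ℝ) (y : EuclideanSpace ℝ (Fin d)) : ℝ :=
  if h : ∃ c : Finset (EuclideanSpace ℝ (Fin d)) × (EuclideanSpace ℝ (Fin d) → ℝ),
      c.1 ∈ T.faces ∧ IsBarycentric c.1 c.2 y
  then ∑ v ∈ h.choose.1, h.choose.2 v * f v
  else 0

theorem IsBarycentric.eq_of_affineIndependent {d : ℕ} {s : Finset (EuclideanSpace ℝ (Fin d))}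
    (hs : AffineIndependent ℝ ((↑) : s → EuclideanSpace ℝ (Fin d)))
    {w u : EuclideanSpace ℝ (Fin d) → ℝ} {y : EuclideanSpace ℝ (Fin d)}
    (hw : IsBarycentric s w y) (hu : IsBarycentric s u y) : ∀ v ∈ s, w v = u v := by
  intro v hv
  have key := affineIndependent_iff.1 hs s.attach (fun i => w i - u i)
    (by rw [Finset.sum_attach s (fun i => w i - u i), Finset.sum_sub_distrib,
          hw.sum_eq_one, hu.sum_eq_one, sub_self])
    (by
      have : ∑ e ∈ s.attach, (w e - u e) • (e : EuclideanSpace ℝ (Fin d))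
          = ∑ e ∈ s, (w e - u e) • e := Finset.sum_attach s (fun e => (w e - u e) • e)
      rw [this]
      simp only [sub_smul, Finset.sum_sub_distrib]
      rw [hw.sum_smul, hu.sum_smul, sub_self])
    ⟨v, hv⟩ (Finset.mem_attach _ _)
  exact sub_eq_zero.1 key

theorem IsBarycentric.mem_convexHull {d : ℕ} {s : Finset (EuclideanSpace ℝ (Fin d))}
    {w : EuclideanSpace ℝ (Fin d) → ℝ} {y : EuclideanSpace ℝ (Fin d)}
    (hw : IsBarycentric s w y) :
    y ∈ convexHull ℝ (s : Set (EuclideanSpace ℝ (Fin d))) :=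
  Finset.mem_convexHull'.2 ⟨w, hw.nonneg, hw.sum_eq_one, hw.sum_smul⟩

open Classical in
theorem IsBarycentric.sum_eq_sum_of_subset {d : ℕ} {s r : Finset (EuclideanSpace ℝ (Fin d))}
    (hs : AffineIndependent ℝ ((↑) : s → EuclideanSpace ℝ (Fin d))) (hr : r ⊆ s)
    {w z : EuclideanSpace ℝ (Fin d) → ℝ} {y : EuclideanSpace ℝ (Fin d)}
    (hw : IsBarycentric s w y) (hz : IsBarycentric r z y)
    (f : EuclideanSpace ℝ (Fin d) → ℝ) :
    ∑ v ∈ s, w v * f v = ∑ v ∈ r, z v * f v := by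
  have h := hw.eq_of_affineIndependent hs (u := fun v => if v ∈ r then z v else 0)
    ⟨fun v _ => by
        by_cases hv : v ∈ r
        · simpa [hv] using hz.nonneg v hv
        · simp [hv],
      by rw [← Finset.sum_filter, Finset.filter_mem_eq_inter, Finset.inter_eq_right.2 hr,
        hz.sum_eq_one],
      by
        simp only [ite_smul, zero_smul]
        rw [← Finset.sum_filter, Finset.filter_mem_eq_inter, Finset.inter_eq_right.2 hr,
          hz.sum_smul]⟩
  rw [Finset.sum_congr rfl fun v hv => by rw [h v hv]]
  simp only [ite_mul, zero_mul]
  rw [← Finset.sum_filter, Finset.filter_mem_eq_inter, Finset.inter_eq_right.2 hr]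

/-- The linear interpolation is given by the barycentric formula in every simplex of `T`. -/
theorem linearInterpolation_eq {d : ℕ}
    (T : Geometry.SimplicialComplex ℝ (EuclideanSpace ℝ (Fin d)))
    (f : EuclideanSpace ℝ (Fin d) → ℝ) {s : Finset (EuclideanSpace ℝ (Fin d))}
    (hs : s ∈ T.faces) {w : EuclideanSpace ℝ (Fin d) → ℝ} {y : EuclideanSpace ℝ (Fin d)}
    (hw : IsBarycentric s w y) : linearInterpolation T f y = ∑ v ∈ s, w v * f v := by
  classical
  have h : ∃ c : Finset (EuclideanSpace ℝ (Fin d)) × (EuclideanSpace ℝ (Fin d) → ℝ),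
      c.1 ∈ T.faces ∧ IsBarycentric c.1 c.2 y := ⟨(s, w), hs, hw⟩
  obtain ⟨ht, hu⟩ := h.choose_spec
  have hy := T.inter_subset_convexHull hs ht ⟨hw.mem_convexHull, hu.mem_convexHull⟩
  rw [← Finset.coe_inter] at hy
  obtain ⟨z, h0, h1, h2⟩ := Finset.mem_convexHull'.1 hy
  have hz : IsBarycentric (s ∩ h.choose.1) z y := ⟨h0, h1, h2⟩
  rw [linearInterpolation, dif_pos h,
    hu.sum_eq_sum_of_subset (T.indep ht) Finset.inter_subset_right hz f,
    hw.sum_eq_sum_of_subset (T.indep hs) Finset.inter_subset_left hz f]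

/-- The `L^p` interpolation error `‖f - f_T‖` of `f` on the region triangulated by `T`, where `f_T`
is the piecewise linear interpolation of `f` based on `T`. -/
noncomputable def interpolationError {d : ℕ} (μ : Measure (EuclideanSpace ℝ (Fin d)))
    (T : Geometry.SimplicialComplex ℝ (EuclideanSpace ℝ (Fin d)))
    (f : EuclideanSpace ℝ (Fin d) → ℝ) (p : ℝ≥0∞) : ℝ≥0∞ :=
  eLpNorm (fun y => f y - linearInterpolation T f y) p (μ.restrict T.space)

/-! Lift `X` to the graph of `Q`. An empty circumscribed `Q`-ball is an affine function below `Q` on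
`X` and equal to `Q` at the vertices of the simplex (`exists_support`), so on that simplex the
Delaunay interpolant is this function and lies below every other interpolant. It lies above `Q` by a
Jensen inequality for points at nonnegative mutual `Q` (`map_sum_smul_le`). The errors are thus
ordered pointwise, hence in every `L^p`.

For existence, take the lower hull of the lifted points. Among weights on `X` with given mass and
barycentre, minimise height, then the coordinates lexicographically; the faces are the sets on which
every weight is minimal. Uniqueness of minimisers gives a simplicial complex, compactness gives
covering, Farkas gives the supporting affine functions, and spacelike position makes every point of
`X` a vertex. -/

/-- **Farkas' lemma** for finitely many vectors: `b` is a nonnegative combination of the `a i`, or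
a linear functional separates it from all of them. -/
theorem exists_nonneg_combination_or_exists_separating {V ι : Type*} [AddCommGroup V]
    [Module ℝ V] (s : Finset ι) (a : ι → V) (b : V) :
    (∃ c : ι → ℝ, (∀ i, 0 ≤ c i) ∧ ∑ i ∈ s, c i • a i = b) ∨
      ∃ f : V →ₗ[ℝ] ℝ, (∀ i ∈ s, 0 ≤ f (a i)) ∧ f b < 0 := by
  classical
  induction s using Finset.induction_on generalizing a b with
  | empty =>
    by_cases hb : b = 0
    · exact Or.inl ⟨0, fun _ => le_rfl, by simp [hb]⟩
    · obtain ⟨f, hf⟩ := Module.Projective.exists_dual_eq_one ℝ hb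
      exact Or.inr ⟨-f, by simp, by simp [hf]⟩
  | insert j s hj ih =>
    rcases ih a b with ⟨c, hc, hcb⟩ | ⟨f, hf, hfb⟩
    · refine Or.inl ⟨fun i => if i = j then 0 else c i, fun i => ?_, ?_⟩
      · dsimp only
        split_ifs
        exacts [le_rfl, hc i]
      · simp only [Finset.sum_insert hj, if_true, zero_smul, zero_add, ← hcb]
        exact Finset.sum_congr rfl fun i hi => by rw [if_neg (ne_of_mem_of_not_mem hi hj)]
    rcases le_or_gt 0 (f (a j)) with hfj | hfj
    · exact Or.inr ⟨f, by simpa [hfj] using hf, hfb⟩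
    -- Project everything along `a j` into the kernel of `f` and apply the induction hypothesis
    -- there.
    rcases ih (fun i => a i - (f (a i) / f (a j)) • a j) (b - (f b / f (a j)) • a j) with
      ⟨c, hc, hcb⟩ | ⟨g, hg, hgb⟩
    · refine Or.inl ⟨fun i => if i = j then f b / f (a j) - ∑ k ∈ s, c k * (f (a k) / f (a j))
        else c i, fun i => ?_, ?_⟩
      · dsimp only
        split_ifs
        · have h1 : 0 ≤ f b / f (a j) := div_nonneg_of_nonpos hfb.le hfj.le
          have h2 : ∑ k ∈ s, c k * (f (a k) / f (a j)) ≤ 0 := Finset.sum_nonpos fun k hk =>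
            mul_nonpos_of_nonneg_of_nonpos (hc k) (div_nonpos_of_nonneg_of_nonpos (hf k hk) hfj.le)
          linarith
        · exact hc i
      · have h : ∑ i ∈ s, (if i = j then f b / f (a j) - ∑ k ∈ s, c k * (f (a k) / f (a j))
            else c i) • a i = ∑ i ∈ s, c i • a i :=
          Finset.sum_congr rfl fun i hi => by rw [if_neg (ne_of_mem_of_not_mem hi hj)]
        simp only [Finset.sum_insert hj, h, if_true]
        simp only [smul_sub, Finset.sum_sub_distrib, smul_smul, ← Finset.sum_smul] at hcb
        rw [sub_smul, sub_eq_iff_eq_add.1 hcb]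
        abel
    · refine Or.inr ⟨g ∘ₗ (LinearMap.id - (f.smulRight ((f (a j))⁻¹ • a j))), ?_, ?_⟩
      · intro i hi
        rcases Finset.mem_insert.1 hi with rfl | hi
        · simp [smul_smul, hfj.ne]
        · simpa [smul_smul, div_eq_mul_inv] using hg i hi
      · simpa [smul_smul, div_eq_mul_inv] using hgb

/-! ### Lexicographic minimisation -/

/-- Nonnegativity with respect to the lexicographic preorder defined by a list of linear
functionals. -/
def LexNonneg {W : Type*} [AddCommGroup W] [Module ℝ W] [TopologicalSpace W] :
    List (W →L[ℝ] ℝ) → W → Prop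
  | [], _ => True
  | f :: l, z => 0 < f z ∨ f z = 0 ∧ LexNonneg l z

section LexNonneg

variable {W : Type*} [AddCommGroup W] [Module ℝ W] [TopologicalSpace W]

theorem LexNonneg.eq_zero {l : List (W →L[ℝ] ℝ)} {z : W} (h : LexNonneg l z)
    (h' : LexNonneg l (-z)) : ∀ f ∈ l, f z = 0 := by
  induction l with
  | nil => simp
  | cons f l ih =>
    simp only [LexNonneg, map_neg, Left.neg_pos_iff, neg_eq_zero] at h h'
    have h0 : f z = 0 := by grind
    intro g hg
    rcases List.mem_cons.1 hg with rfl | hg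
    · exact h0
    · exact ih (by grind) (by grind) g hg

theorem lexNonneg_zero (l : List (W →L[ℝ] ℝ)) : LexNonneg l 0 := by
  induction l with
  | nil => trivial
  | cons f l ih => exact Or.inr ⟨map_zero f, ih⟩

theorem LexNonneg.smul {l : List (W →L[ℝ] ℝ)} {z : W} (h : LexNonneg l z) {c : ℝ} (hc : 0 < c) :
    LexNonneg l (c • z) := by
  induction l with
  | nil => trivial
  | cons f l ih =>
    rcases h with h | ⟨h, h'⟩
    · exact Or.inl (by rw [map_smul]; exact mul_pos hc h)
    · exact Or.inr ⟨by rw [map_smul, h, smul_zero], ih h'⟩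

/-- The minimisers of the first functional form a compact slice, on which the remaining functionals
are minimised. -/
theorem IsCompact.exists_lexNonneg_sub (l : List (W →L[ℝ] ℝ)) {K : Set W} (hK : IsCompact K)
    (hne : K.Nonempty) : ∃ w ∈ K, ∀ u ∈ K, LexNonneg l (u - w) := by
  induction l generalizing K with
  | nil => exact ⟨hne.some, hne.some_mem, fun _ _ => trivial⟩
  | cons f l ih =>
    obtain ⟨w₀, hw₀, hmin⟩ := hK.exists_isMinOn hne f.continuous.continuousOn
    obtain ⟨w, ⟨hw, hfw⟩, h⟩ := ih
      (hK.inter_right (isClosed_singleton.preimage f.continuous : IsClosed (f ⁻¹' {f w₀})))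
      ⟨w₀, hw₀, rfl⟩
    refine ⟨w, hw, fun u hu => ?_⟩
    have hfw : f w = f w₀ := hfw
    rcases (isMinOn_iff.1 hmin u hu).lt_or_eq with h' | h'
    · exact Or.inl (by rw [map_sub]; linarith)
    · exact Or.inr ⟨by rw [map_sub]; linarith, h u ⟨hu, h'.symm⟩⟩

end LexNonneg

/-! ### Regular triangulations by lexicographic tie-breaking -/

section LexFace

variable {E : Type*}

/-- `w` is a nonnegative weight concentrated on `s`. -/
structure IsWeightOn (s : Finset E) (w : E → ℝ) : Prop where
  nonneg : ∀ v, 0 ≤ w v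
  eq_zero : ∀ v ∉ s, w v = 0

theorem IsWeightOn.mono {s t : Finset E} {w : E → ℝ} (h : IsWeightOn s w) (hst : s ⊆ t) :
    IsWeightOn t w :=
  ⟨h.nonneg, fun v hv => h.eq_zero v fun hs => hv (hst hs)⟩

/-- The functionals comparing weights on `X`: first the height, then every coordinate. -/
noncomputable def heightFunctionals (X : Finset E) (ω : E → ℝ) : List ((E → ℝ) →L[ℝ] ℝ) :=
  (∑ v ∈ X, ω v • ContinuousLinearMap.proj v) :: X.toList.map fun v => ContinuousLinearMap.proj v

theorem heightFunctional_apply (X : Finset E) (ω z : E → ℝ) :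
    (∑ v ∈ X, ω v • ContinuousLinearMap.proj (R := ℝ) (φ := fun _ : E => ℝ) v) z =
      ∑ v ∈ X, z v * ω v := by
  simp [sum_apply, mul_comm]

/-- Listing the coordinates after the height makes the preorder antisymmetric on weights, so no ties
survive. -/
theorem eq_zero_of_lexNonneg_heightFunctionals {X : Finset E} {ω z : E → ℝ}
    (h : LexNonneg (heightFunctionals X ω) z) (h' : LexNonneg (heightFunctionals X ω) (-z)) :
    ∀ v ∈ X, z v = 0 := fun v hv =>
  h.eq_zero h' (ContinuousLinearMap.proj v)
    (List.mem_cons_of_mem _ (List.mem_map.2 ⟨v, Finset.mem_toList.2 hv, rfl⟩))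

variable [AddCommGroup E] [Module ℝ E]

/-- `w` and `u` have the same total mass and the same barycentre over `X`. -/
structure SameBarycentre (X : Finset E) (w u : E → ℝ) : Prop where
  mass : ∑ v ∈ X, w v = ∑ v ∈ X, u v
  moment : ∑ v ∈ X, w v • v = ∑ v ∈ X, u v • v

/-- Faces of the regular triangulation of `X` induced by the heights `ω`, ties being broken
lexicographically. -/
structure IsLexFace (X : Finset E) (ω : E → ℝ) (s : Finset E) : Prop where
  nonempty : s.Nonempty
  subset : s ⊆ X
  lexNonneg : ∀ w u, IsWeightOn s w → IsWeightOn X u → SameBarycentre X w u →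
    LexNonneg (heightFunctionals X ω) (u - w)

variable {X s t : Finset E} {ω : E → ℝ}

theorem IsLexFace.mono (h : IsLexFace X ω s) (hts : t ⊆ s) (ht : t.Nonempty) :
    IsLexFace X ω t :=
  ⟨ht, hts.trans h.subset, fun w u hw => h.lexNonneg w u (hw.mono hts)⟩

theorem IsLexFace.height_le (h : IsLexFace X ω s) {w u : E → ℝ} (hw : IsWeightOn s w)
    (hu : IsWeightOn X u) (hwu : SameBarycentre X w u) :
    ∑ v ∈ X, w v * ω v ≤ ∑ v ∈ X, u v * ω v := by
  have key := heightFunctional_apply X ω (u - w)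
  simp only [Pi.sub_apply, sub_mul, Finset.sum_sub_distrib] at key
  rcases h.lexNonneg w u hw hu hwu with h | ⟨h, -⟩ <;> linarith

theorem IsLexFace.weight_unique (hs : IsLexFace X ω s) (ht : IsLexFace X ω t) {w u : E → ℝ}
    (hw : IsWeightOn s w) (hu : IsWeightOn t u) (hwu : SameBarycentre X w u) : w = u := by
  have h1 := hs.lexNonneg w u hw (hu.mono ht.subset) hwu
  have h2 := ht.lexNonneg u w hu (hw.mono hs.subset) ⟨hwu.mass.symm, hwu.moment.symm⟩
  rw [← neg_sub] at h2
  funext v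
  by_cases hv : v ∈ X
  · exact (sub_eq_zero.1 (eq_zero_of_lexNonneg_heightFunctionals h1 h2 v hv)).symm
  · rw [hw.eq_zero v fun h => hv (hs.subset h), hu.eq_zero v fun h => hv (ht.subset h)]

theorem IsLexFace.affineIndependent (h : IsLexFace X ω s) :
    AffineIndependent ℝ ((↑) : s → E) := by
  classical
  rw [affineIndependent_iff]
  intro t g hg hgs e he
  let z : E → ℝ := fun v => if hv : v ∈ s then if (⟨v, hv⟩ : s) ∈ t then g ⟨v, hv⟩ else 0 else 0
  have hz : ∀ e : s, z e = if e ∈ t then g e else 0 := fun e => by simp [z]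
  have hz0 : ∀ v ∉ s, z v = 0 := fun v hv => by simp [z, hv]
  have hsum : ∑ v ∈ X, z v = 0 := by
    rw [← Finset.sum_subset h.subset fun v _ hv => hz0 v hv, ← Finset.sum_attach]
    simp only [hz]
    rw [← Finset.sum_filter, Finset.filter_mem_eq_inter,
      Finset.inter_eq_right.2 fun e _ => Finset.mem_attach s e, hg]
  have hmom : ∑ v ∈ X, z v • v = 0 := by
    rw [← Finset.sum_subset h.subset fun v _ hv => by rw [hz0 v hv, zero_smul],
      ← Finset.sum_attach]
    simp only [hz, ite_smul, zero_smul]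
    rw [← Finset.sum_filter, Finset.filter_mem_eq_inter,
      Finset.inter_eq_right.2 fun e _ => Finset.mem_attach s e, hgs]
  -- An affine dependence `z` would give two weights on `s` with equal mass and barycentre; adding
  -- `|z|` keeps both nonnegative.
  have hw := h.weight_unique h (w := fun v => |z v|) (u := fun v => |z v| + z v)
    ⟨fun v => abs_nonneg _, fun v hv => by simp [hz0 v hv]⟩
    ⟨fun v => by linarith [neg_abs_le (z v)], fun v hv => by simp [hz0 v hv]⟩
    ⟨by rw [Finset.sum_add_distrib, hsum, add_zero],
      by simp only [add_smul]; rw [Finset.sum_add_distrib, hmom, add_zero]⟩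
  have := congrFun hw e
  simpa [hz, he] using this

theorem exists_isWeightOn_of_mem_convexHull (hsX : s ⊆ X) {y : E}
    (hy : y ∈ convexHull ℝ (s : Set E)) :
    ∃ w, IsWeightOn s w ∧ ∑ v ∈ X, w v = 1 ∧ ∑ v ∈ X, w v • v = y := by
  classical
  obtain ⟨w, h0, h1, h2⟩ := Finset.mem_convexHull'.1 hy
  refine ⟨fun v => if v ∈ s then w v else 0, ⟨fun v => ?_, fun v hv => if_neg hv⟩, ?_, ?_⟩
  · split_ifs with hv
    exacts [h0 v hv, le_rfl]
  · rw [← Finset.sum_filter, Finset.filter_mem_eq_inter, Finset.inter_eq_right.2 hsX, h1]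
  · simp only [ite_smul, zero_smul]
    rw [← Finset.sum_filter, Finset.filter_mem_eq_inter, Finset.inter_eq_right.2 hsX, h2]

theorem IsWeightOn.mem_convexHull {w : E → ℝ} (hw : IsWeightOn s w) (hsX : s ⊆ X) {y : E}
    (h1 : ∑ v ∈ X, w v = 1) (h2 : ∑ v ∈ X, w v • v = y) : y ∈ convexHull ℝ (s : Set E) := by
  refine Finset.mem_convexHull'.2 ⟨w, fun v _ => hw.nonneg v, ?_, ?_⟩
  · rw [← h1]
    exact Finset.sum_subset hsX fun v _ hv => hw.eq_zero v hv
  · rw [← h2]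
    exact Finset.sum_subset hsX fun v _ hv => by rw [hw.eq_zero v hv, zero_smul]

/-- A common point has the same weight in both faces, so that weight vanishes off `s ∩ t`. -/
theorem IsLexFace.convexHull_inter_subset (hs : IsLexFace X ω s) (ht : IsLexFace X ω t) :
    convexHull ℝ (s : Set E) ∩ convexHull ℝ (t : Set E) ⊆ convexHull ℝ (s ∩ t : Set E) := by
  classical
  rintro y ⟨hys, hyt⟩
  obtain ⟨w, hw, hw1, hwy⟩ := exists_isWeightOn_of_mem_convexHull hs.subset hys
  obtain ⟨u, hu, hu1, huy⟩ := exists_isWeightOn_of_mem_convexHull ht.subset hyt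
  obtain rfl := hs.weight_unique ht hw hu ⟨hw1.trans hu1.symm, hwy.trans huy.symm⟩
  rw [← Finset.coe_inter]
  refine IsWeightOn.mem_convexHull (w := w) ⟨hw.nonneg, fun v hv => ?_⟩
    (Finset.inter_subset_left.trans hs.subset) hw1 hwy
  by_cases hvs : v ∈ s
  · exact hu.eq_zero v fun hvt => hv (Finset.mem_inter.2 ⟨hvs, hvt⟩)
  · exact hw.eq_zero v hvs

theorem isCompact_setOf_isWeightOn [TopologicalSpace E] [T2Space E] [ContinuousAdd E]
    [ContinuousSMul ℝ E] (X : Finset E) (y : E) :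
    IsCompact {w | IsWeightOn X w ∧ ∑ v ∈ X, w v = 1 ∧ ∑ v ∈ X, w v • v = y} := by
  classical
  have hbox : IsCompact (Set.pi Set.univ fun v : E => if v ∈ X then Set.Icc (0 : ℝ) 1 else {0}) :=
    isCompact_univ_pi fun v => by split_ifs; exacts [isCompact_Icc, isCompact_singleton]
  have hmass : IsClosed {w : E → ℝ | ∑ v ∈ X, w v = 1} :=
    isClosed_eq (by fun_prop) continuous_const
  have hmoment : IsClosed {w : E → ℝ | ∑ v ∈ X, w v • v = y} :=
    isClosed_eq (by fun_prop) continuous_const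
  convert (hbox.inter_right hmass).inter_right hmoment using 1
  ext w
  simp only [Set.mem_ofPred_eq, Set.mem_inter_iff, Set.mem_univ_pi, ← and_assoc]
  refine and_congr_left fun _ => and_congr_left fun hw1 => ⟨fun hw v => ?_, fun h => ⟨fun v => ?_,
    fun v hv => ?_⟩⟩
  · split_ifs with hv
    · exact ⟨hw.nonneg v, hw1 ▸ Finset.single_le_sum (fun v _ => hw.nonneg v) hv⟩
    · exact hw.eq_zero v hv
  · have := h v
    split_ifs at this
    exacts [this.1, this.ge]
  · simpa [hv] using h v

/-- The face is the support of the lexicographically least weight representing `y`. -/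
theorem exists_isLexFace_mem_convexHull [TopologicalSpace E] [T2Space E] [ContinuousAdd E]
    [ContinuousSMul ℝ E] (ω : E → ℝ) {y : E} (hy : y ∈ convexHull ℝ (X : Set E)) :
    ∃ s, IsLexFace X ω s ∧ y ∈ convexHull ℝ (s : Set E) := by
  classical
  obtain ⟨w, ⟨hw, hw1, hwy⟩, hmin⟩ := (isCompact_setOf_isWeightOn X y).exists_lexNonneg_sub
    (heightFunctionals X ω) (exists_isWeightOn_of_mem_convexHull subset_rfl hy)
  have hws : IsWeightOn (X.filter fun v => 0 < w v) w := by
    refine ⟨hw.nonneg, fun v hv => ?_⟩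
    by_cases hvX : v ∈ X
    · exact le_antisymm (not_lt.1 fun h => hv (Finset.mem_filter.2 ⟨hvX, h⟩)) (hw.nonneg v)
    · exact hw.eq_zero v hvX
  refine ⟨X.filter fun v => 0 < w v, ⟨?_, Finset.filter_subset _ _, ?_⟩,
    hws.mem_convexHull (Finset.filter_subset _ _) hw1 hwy⟩
  · exact Finset.coe_nonempty.1 (convexHull_nonempty_iff.1
      ⟨y, hws.mem_convexHull (Finset.filter_subset _ _) hw1 hwy⟩)
  intro w' u hw' hu hwu
  -- Since `w` is positive on its support, which carries `w'`, a small step from `w` along `u - w'`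
  -- remains a weight; minimality of `w` then controls the sign of `u - w'`.
  have hδ : ∀ᶠ δ : ℝ in nhdsWithin 0 (Set.Ioi 0), ∀ v ∈ X.filter fun v => 0 < w v,
      δ * w' v < w v := by
    refine (Filter.eventually_all_finset _).2 fun v hv => ?_
    have hc : Filter.Tendsto (fun δ : ℝ => δ * w' v) (nhdsWithin 0 (Set.Ioi 0)) (nhds (0 * w' v)) :=
      ((continuous_id.mul continuous_const).tendsto 0).mono_left nhdsWithin_le_nhds
    exact hc.eventually_lt_const (by simpa using (Finset.mem_filter.1 hv).2)
  obtain ⟨δ, hδ, hδ0⟩ := (hδ.and self_mem_nhdsWithin).exists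
  have hδ0 : 0 < δ := hδ0
  have hle : ∀ v, δ * w' v ≤ w v := fun v => by
    by_cases hv : v ∈ X.filter fun v => 0 < w v
    · exact (hδ v hv).le
    · rw [hw'.eq_zero v hv, mul_zero]
      exact hw.nonneg v
  have key := hmin (fun v => w v + δ * (u v - w' v)) ⟨⟨fun v => ?_, fun v hv => ?_⟩, ?_, ?_⟩
  · have : u - w' = δ⁻¹ • ((fun v => w v + δ * (u v - w' v)) - w) := by
      funext v
      simp [hδ0.ne']
    rw [this]
    exact key.smul (inv_pos.2 hδ0)
  · have := mul_nonneg hδ0.le (hu.nonneg v)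
    linarith [hle v]
  · rw [hw.eq_zero v hv, hu.eq_zero v hv, hw'.eq_zero v fun h => hv (Finset.mem_filter.1 h).1]
    simp
  · rw [Finset.sum_add_distrib, ← Finset.mul_sum, Finset.sum_sub_distrib, hwu.mass, hw1]
    simp
  · simp only [add_smul, mul_smul, sub_smul]
    rw [Finset.sum_add_distrib, ← Finset.smul_sum, Finset.sum_sub_distrib, hwu.moment, hwy]
    simp

/-- The regular triangulation of `X` induced by the heights `ω`. -/
def lexComplex (X : Finset E) (ω : E → ℝ) : Geometry.SimplicialComplex ℝ E where
  faces := {s | IsLexFace X ω s}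
  isRelLowerSet_faces := fun _ hs => ⟨hs.nonempty, fun _ hts ht => hs.mono hts ht⟩
  indep hs := hs.affineIndependent
  inter_subset_convexHull hs ht := hs.convexHull_inter_subset ht

theorem space_lexComplex [TopologicalSpace E] [T2Space E] [ContinuousAdd E]
    [ContinuousSMul ℝ E] (X : Finset E) (ω : E → ℝ) :
    (lexComplex X ω).space = convexHull ℝ (X : Set E) := by
  ext y
  rw [Geometry.SimplicialComplex.mem_space_iff]
  constructor
  · rintro ⟨s, hs, hy⟩
    exact convexHull_mono (Finset.coe_subset.2 hs.subset) hy
  · exact exists_isLexFace_mem_convexHull ω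

/-- Every face of the regular triangulation lies below a supporting affine function. -/
theorem IsLexFace.exists_affine_support (h : IsLexFace X ω s) :
    ∃ (φ : E →ₗ[ℝ] ℝ) (D : ℝ), (∀ x ∈ X, φ x + D ≤ ω x) ∧ ∀ x ∈ s, φ x + D = ω x := by
  classical
  let p : E → E × ℝ × ℝ := fun v => (v, 1, ω v)
  -- A nonnegative combination would yield a weight on `X` lower by `1` than a weight on `s` with
  -- the same mass and barycentre. Including `-p v` for `v ∈ s` forces equality on the face.
  rcases exists_nonneg_combination_or_exists_separating (X.disjSum s)
    (Sum.elim p fun v => -p v) ((0, 0, -1) : E × ℝ × ℝ) with ⟨c, hc, hcb⟩ | ⟨f, hf, hfb⟩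
  · exfalso
    let u : E → ℝ := fun v => if v ∈ X then c (Sum.inl v) else 0
    let w : E → ℝ := fun v => if v ∈ s then c (Sum.inr v) else 0
    have hu : IsWeightOn X u := ⟨fun v => by dsimp only [u]; split_ifs; exacts [hc _, le_rfl],
      fun v hv => if_neg hv⟩
    have hw : IsWeightOn s w := ⟨fun v => by dsimp only [w]; split_ifs; exacts [hc _, le_rfl],
      fun v hv => if_neg hv⟩
    have hsum : ∑ v ∈ X, u v • p v - ∑ v ∈ X, w v • p v = (0, 0, -1) := by
      rw [← hcb, Finset.sum_disjSum,
        ← Finset.sum_subset (f := fun v => w v • p v) h.subset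
          fun v _ hv => by rw [hw.eq_zero v hv, zero_smul],
        sub_eq_add_neg, ← Finset.sum_neg_distrib]
      congr 1
      · exact Finset.sum_congr rfl fun v hv => by simp [u, hv]
      · exact Finset.sum_congr rfl fun v hv => by simp [w, hv]
    have h1 := congrArg Prod.fst hsum
    have h2 := congrArg (fun q => q.2.1) hsum
    have h3 := congrArg (fun q => q.2.2) hsum
    simp only [p, Prod.fst_sub, Prod.snd_sub, Prod.fst_sum, Prod.snd_sum, Prod.smul_fst,
      Prod.smul_snd, smul_eq_mul, mul_one] at h1 h2 h3
    have := h.height_le hw hu ⟨(sub_eq_zero.1 h2).symm, (sub_eq_zero.1 h1).symm⟩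
    linarith
  · have hfp : ∀ v, f (p v) = f (v, 0, 0) + f (0, 1, 0) + ω v * f (0, 0, 1) := fun v => by
      rw [← smul_eq_mul, ← map_smul, ← map_add, ← map_add]
      simp [p]
    -- The separating hyperplane is not vertical, so it is the graph of an affine function.
    have hγ : 0 < f (0, 0, 1) := by
      have : ((0, 0, -1) : E × ℝ × ℝ) = -(0, 0, 1) := by simp
      rw [this, map_neg] at hfb
      linarith
    have hX : ∀ v ∈ X, 0 ≤ f (p v) := fun v hv => by
      simpa using hf (Sum.inl v) (Finset.inl_mem_disjSum.2 hv)
    have hsupport : ∀ v, ((-(f (0, 0, 1))⁻¹) • (f ∘ₗ LinearMap.inl ℝ E (ℝ × ℝ))) v +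
        -(f (0, 0, 1))⁻¹ * f (0, 1, 0) = ω v - (f (0, 0, 1))⁻¹ * f (p v) := fun v => by
      have hv : f (v, 0) = f (v, 0, 0) := rfl
      rw [hfp]
      simp only [LinearMap.smul_apply, LinearMap.comp_apply, LinearMap.inl_apply, smul_eq_mul, hv]
      field_simp
      ring
    refine ⟨(-(f (0, 0, 1))⁻¹) • (f ∘ₗ LinearMap.inl ℝ E (ℝ × ℝ)),
      -(f (0, 0, 1))⁻¹ * f (0, 1, 0), fun x hx => ?_, fun x hx => ?_⟩
    · rw [hsupport]
      have := mul_nonneg (inv_pos.2 hγ).le (hX x hx)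
      linarith
    · have h1 := hX x (h.subset hx)
      have h2 : 0 ≤ -f (p x) := by
        simpa using hf (Sum.inr x) (Finset.inr_mem_disjSum.2 hx)
      rw [hsupport, le_antisymm (neg_nonneg.1 h2) h1, mul_zero, sub_zero]

end LexFace

/-! ### Variance and Jensen inequality for a quadratic form -/

namespace QuadraticMap

variable {E : Type*} [AddCommGroup E] [Module ℝ E]

/-- The weighted variance identity for a quadratic form. -/
theorem sum_smul_sub_eq (Q : QuadraticForm ℝ E) (s : Finset E) (w : E → ℝ) (y : E) :
    ∑ v ∈ s, w v * Q (v - y) =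
      ∑ v ∈ s, w v * Q v - polar Q (∑ v ∈ s, w v • v) y + (∑ v ∈ s, w v) * Q y := by
  have h : ∀ v, w v * Q (v - y) = w v * Q v - polar Q (w v • v) y + w v * Q y := fun v => by
    rw [sub_eq_add_neg, QuadraticMap.map_add Q, QuadraticMap.map_neg, polar_neg_right,
      polar_smul_left, smul_eq_mul]
    ring
  have hp : polar Q (∑ v ∈ s, w v • v) y = ∑ v ∈ s, polar Q (w v • v) y := by
    simp only [← polarBilin_apply_apply, map_sum, LinearMap.sum_apply]
  simp only [h, Finset.sum_add_distrib, Finset.sum_sub_distrib, hp, Finset.sum_mul]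

/-- Averaging the variance identity over `y` writes twice the gap as the sum of `w v * w y * Q (v -
y)`. -/
theorem map_sum_smul_le (Q : QuadraticForm ℝ E) {s : Finset E} {w : E → ℝ}
    (hw0 : ∀ v ∈ s, 0 ≤ w v) (hw : ∑ v ∈ s, w v = 1)
    (hQ : ∀ x ∈ s, ∀ y ∈ s, 0 ≤ Q (x - y)) :
    Q (∑ v ∈ s, w v • v) ≤ ∑ v ∈ s, w v * Q v := by
  have h : ∑ y ∈ s, w y * ∑ v ∈ s, w v * Q (v - y) =
      2 * (∑ v ∈ s, w v * Q v - Q (∑ v ∈ s, w v • v)) := by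
    have hp : ∑ y ∈ s, w y * polar Q (∑ v ∈ s, w v • v) y =
        polar Q (∑ v ∈ s, w v • v) (∑ v ∈ s, w v • v) := by
      simp only [← smul_eq_mul, ← polar_smul_right]
      simp only [← polarBilin_apply_apply, map_sum]
    simp only [sum_smul_sub_eq, hw, mul_add, mul_sub, Finset.sum_add_distrib,
      Finset.sum_sub_distrib, hp, polar_self, one_mul, ← Finset.sum_mul]
    ring
  have h0 : 0 ≤ ∑ y ∈ s, w y * ∑ v ∈ s, w v * Q (v - y) :=
    Finset.sum_nonneg fun y hy => mul_nonneg (hw0 y hy)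
      (Finset.sum_nonneg fun v hv => mul_nonneg (hw0 v hv) (hQ v hv y hy))
  linarith

end QuadraticMap

/-! ### Empty `Q`-balls, Delaunay triangulations and optimality -/

section QBall

variable {d : ℕ} {Q : QuadraticForm ℝ (EuclideanSpace ℝ (Fin d))}
  {X s : Finset (EuclideanSpace ℝ (Fin d))}

theorem QuadraticForm.continuous_sub_affine (Q : QuadraticForm ℝ (EuclideanSpace ℝ (Fin d)))
    (φ : EuclideanSpace ℝ (Fin d) →ₗ[ℝ] ℝ) (D : ℝ) : Continuous fun x => Q x - (φ x + D) := by
  have hQ : Continuous Q := by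
    let L : EuclideanSpace ℝ (Fin d) →ₗ[ℝ] EuclideanSpace ℝ (Fin d) →L[ℝ] ℝ :=
      (LinearMap.toContinuousLinearMap (E := EuclideanSpace ℝ (Fin d)) (F' := ℝ)).toLinearMap ∘ₗ
        Q.polarBilin
    have hL : Continuous fun x => L x x :=
      L.continuous_of_finiteDimensional.clm_apply continuous_id
    have h : ∀ x, Q x = 2⁻¹ * L x x := fun x => by
      simp [L]
    exact (continuous_const.mul hL).congr fun x => (h x).symm
  have hφ : Continuous φ := φ.continuous_of_finiteDimensional
  fun_prop

theorem IsEmptyCircumscribedQBall.exists_support {B : Set (EuclideanSpace ℝ (Fin d))}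
    (h : IsEmptyCircumscribedQBall Q X s B) :
    ∃ (φ : EuclideanSpace ℝ (Fin d) →ₗ[ℝ] ℝ) (D : ℝ), B = {x | Q x ≤ φ x + D} ∧
      (∀ x ∈ X, φ x + D ≤ Q x) ∧ ∀ x ∈ s, φ x + D = Q x := by
  obtain ⟨φ, D, rfl⟩ := h.isQBall
  have hc := Q.continuous_sub_affine φ D
  refine ⟨φ, D, rfl, fun x hx => ?_, fun x hx => ?_⟩
  · by_contra! hlt
    refine h.empty x hx (mem_interior.2 ⟨{x | Q x - (φ x + D) < 0}, fun y hy => ?_,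
      isOpen_lt hc continuous_const, sub_neg.2 hlt⟩)
    have hy : Q y - (φ y + D) < 0 := hy
    exact (sub_neg.1 hy).le
  · have : Q x - (φ x + D) = 0 := frontier_le_subset_eq hc (continuous_const (y := (0 : ℝ)))
      (by simpa only [sub_nonpos] using h.vertices_on_sphere x hx)
    linarith

/-- A point where `Q` meets an affine function is not interior to the corresponding `Q`-ball if
along some line through the point the difference is not locally nonpositive. -/
theorem notMem_interior_of_pos {φ : EuclideanSpace ℝ (Fin d) →ₗ[ℝ] ℝ} {D : ℝ}
    {x e : EuclideanSpace ℝ (Fin d)} (hx : φ x + D ≤ Q x)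
    (he : 0 < Q e ∨ QuadraticMap.polar Q x e - φ e ≠ 0) :
    x ∉ interior {y | Q y ≤ φ y + D} := by
  intro hint
  have hline : ∀ t : ℝ, Q (x + t • e) - (φ (x + t • e) + D) =
      (Q x - (φ x + D)) + t * (QuadraticMap.polar Q x e - φ e) + t * t * Q e := fun t => by
    rw [QuadraticMap.map_add Q, QuadraticMap.map_smul, QuadraticMap.polar_smul_right, map_add,
      map_smul]
    simp only [smul_eq_mul]
    ring
  have hev : ∀ᶠ t : ℝ in nhds 0, t * (QuadraticMap.polar Q x e - φ e) + t * t * Q e ≤ 0 := by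
    have hc : ContinuousAt (fun t : ℝ => x + t • e) 0 := by fun_prop
    have hmem : ∀ᶠ y in nhds (x + (0 : ℝ) • e), Q y ≤ φ y + D := by
      rw [zero_smul, add_zero]
      exact mem_interior_iff_mem_nhds.1 hint
    filter_upwards [hc.eventually hmem] with t ht
    have := hline t
    linarith
  obtain ⟨ε, hε, hball⟩ := Metric.eventually_nhds_iff.1 hev
  generalize QuadraticMap.polar Q x e - φ e = c at *
  have hpm : ∀ t, |t| < ε → t * c + t * t * Q e ≤ 0 := fun t ht =>
    hball (by simpa using ht)
  have hQ : Q e ≤ 0 := by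
    by_contra! hQ
    -- Adding the values at opposite parameters cancels the linear term.
    have h1 := hpm (ε / 2) (by rw [abs_of_pos (by positivity)]; linarith)
    have h2 := hpm (-(ε / 2)) (by rw [abs_neg, abs_of_pos (by positivity)]; linarith)
    have : 0 < ε / 2 * (ε / 2) * Q e := by positivity
    linarith
  have hc0 : c ≠ 0 := he.resolve_left hQ.not_gt
  have hlim : Filter.Tendsto (fun t : ℝ => c + t * Q e) (nhds 0) (nhds (c + 0 * Q e)) :=
    (show Continuous fun t : ℝ => c + t * Q e by fun_prop).tendsto 0
  rw [zero_mul, add_zero] at hlim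
  rcases hc0.lt_or_gt with hc | hc
  · have h := (hlim.eventually_lt_const hc).and hev
    obtain ⟨t, ⟨h1, h2⟩, ht⟩ := ((h.filter_mono nhdsWithin_le_nhds).and
      (self_mem_nhdsWithin (s := Set.Iio (0 : ℝ)))).exists
    have : 0 < t * (c + t * Q e) := mul_pos_of_neg_of_neg ht h1
    linarith
  · have h := (hlim.eventually_const_lt hc).and hev
    obtain ⟨t, ⟨h1, h2⟩, ht⟩ := ((h.filter_mono nhdsWithin_le_nhds).and
      (self_mem_nhdsWithin (s := Set.Ioi (0 : ℝ)))).exists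
    have : 0 < t * (c + t * Q e) := mul_pos ht h1
    linarith

theorem SpacelikePosition.nonneg (hX : SpacelikePosition Q X) {x y : EuclideanSpace ℝ (Fin d)}
    (hx : x ∈ X) (hy : y ∈ X) : 0 ≤ Q (x - y) := by
  rcases eq_or_ne x y with rfl | h
  · simp
  · exact (hX x hx y hy h).le

/-- Converse of `exists_support`. The directions `e` are needed because, for indefinite or
degenerate `Q`, equality with the affine function does not by itself exclude the interior. -/
theorem SpacelikePosition.isEmptyCircumscribedQBall (hX : SpacelikePosition Q X) (hsX : s ⊆ X)
    {φ : EuclideanSpace ℝ (Fin d) →ₗ[ℝ] ℝ} {D : ℝ} (hle : ∀ x ∈ X, φ x + D ≤ Q x)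
    (heq : ∀ x ∈ s, φ x + D = Q x)
    (he : ∀ x ∈ X, ∃ e, 0 < Q e ∨ QuadraticMap.polar Q x e - φ e ≠ 0) :
    IsEmptyCircumscribedQBall Q X s {x | Q x ≤ φ x + D} where
  isQBall := ⟨φ, D, rfl⟩
  simplex_subset := by
    intro y hy
    obtain ⟨w, h0, h1, rfl⟩ := Finset.mem_convexHull'.1 hy
    refine (Q.map_sum_smul_le h0 h1 fun x hx y hy => hX.nonneg (hsX hx) (hsX hy)).trans_eq ?_
    rw [Finset.sum_congr rfl fun v hv => by rw [← heq v hv, mul_add], Finset.sum_add_distrib,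
      ← Finset.sum_mul, h1, one_mul, map_sum]
    simp
  vertices_on_sphere v hv := by
    obtain ⟨e, he⟩ := he v (hsX hv)
    exact ⟨subset_closure (heq v hv).ge, notMem_interior_of_pos (heq v hv).le he⟩
  empty x hx := by
    obtain ⟨e, he⟩ := he x hx
    exact notMem_interior_of_pos (hle x hx) he

theorem SpacelikePosition.exists_isEmptyCircumscribedQBall (hd : 1 ≤ d)
    (hX : SpacelikePosition Q X) (hs : IsLexFace X Q s) :
    ∃ B, IsEmptyCircumscribedQBall Q X s B := by
  by_cases hpos : ∃ x ∈ X, ∃ y ∈ X, x ≠ y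
  · obtain ⟨x, hx, y, hy, hxy⟩ := hpos
    obtain ⟨φ, D, hle, heq⟩ := hs.exists_affine_support
    exact ⟨_, hX.isEmptyCircumscribedQBall hs.subset hle heq
      fun _ _ => ⟨x - y, Or.inl (hX x hx y hy hxy)⟩⟩
  · push Not at hpos
    obtain ⟨x, hx⟩ := hs.nonempty
    have hxX := hs.subset hx
    have : Nonempty (Fin d) := ⟨⟨0, hd⟩⟩
    -- For a single point `Q` may have no positive direction. The affine function is tilted so that
    -- its difference from `Q` has differential `f` at `x`, nonzero along `e`.
    obtain ⟨e, he⟩ := exists_ne (0 : EuclideanSpace ℝ (Fin d))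
    obtain ⟨f, hf⟩ := Module.Projective.exists_dual_eq_one ℝ he
    have heq : ∀ y ∈ X, (Q.polarBilin x - f) y + (Q x - (Q.polarBilin x - f) x) = Q y :=
      fun y hy => by rw [hpos y hy x hxX]; ring
    refine ⟨_, hX.isEmptyCircumscribedQBall hs.subset (fun y hy => (heq y hy).le)
      (fun y hy => heq y (hs.subset hy)) fun y hy => ⟨e, Or.inr ?_⟩⟩
    rw [hpos y hy x hxX]
    simp [hf]

theorem eq_of_eqOn_of_card {φ ψ : EuclideanSpace ℝ (Fin d) →ₗ[ℝ] ℝ} {D C : ℝ}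
    (hs : AffineIndependent ℝ ((↑) : s → EuclideanSpace ℝ (Fin d))) (hcard : s.card = d + 1)
    (h : ∀ x ∈ s, φ x + D = ψ x + C) (x : EuclideanSpace ℝ (Fin d)) : φ x + D = ψ x + C := by
  have htop : affineSpan ℝ (Set.range ((↑) : s → EuclideanSpace ℝ (Fin d))) = ⊤ :=
    hs.affineSpan_eq_top_iff_card_eq_finrank_add_one.2 (by simp [hcard])
  have := AffineMap.ext_on (f := φ.toAffineMap + AffineMap.const ℝ _ D)
    (g := ψ.toAffineMap + AffineMap.const ℝ _ C) htop
    (by rintro _ ⟨⟨x, hx⟩, rfl⟩; simpa using h x hx)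
  simpa using congrArg (fun f => f x) this

/-- By the variance identity at `x`, a competitor `u` exceeds the height of `w` by the sum of `u v *
Q (v - x)`, which is positive unless `u = w`. -/
theorem SpacelikePosition.isLexFace_singleton (hX : SpacelikePosition Q X)
    {x : EuclideanSpace ℝ (Fin d)} (hx : x ∈ X) : IsLexFace X Q {x} := by
  refine ⟨Finset.singleton_nonempty x, Finset.singleton_subset_iff.2 hx, fun w u hw hu hwu => ?_⟩
  by_cases huw : u = w
  · rw [huw, sub_self]
    exact lexNonneg_zero _
  have hw0 : ∀ v ∈ X, v ≠ x → w v = 0 := fun v _ hv => hw.eq_zero v (by simpa using hv)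
  have hmass : ∑ v ∈ X, w v = w x := Finset.sum_eq_single_of_mem x hx hw0
  have hmoment : ∑ v ∈ X, w v • v = w x • x :=
    Finset.sum_eq_single_of_mem x hx fun v hv hvx => by rw [hw0 v hv hvx, zero_smul]
  have hheight : ∑ v ∈ X, w v * Q v = w x * Q x :=
    Finset.sum_eq_single_of_mem x hx fun v hv hvx => by rw [hw0 v hv hvx, zero_mul]
  have hvar := Q.sum_smul_sub_eq X u x
  rw [← hwu.mass, ← hwu.moment, hmass, hmoment, QuadraticMap.polar_smul_left,
    QuadraticMap.polar_self] at hvar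
  obtain ⟨v, hv, hvx, huv⟩ : ∃ v ∈ X, v ≠ x ∧ u v ≠ 0 := by
    by_contra! h
    refine huw (funext fun v => ?_)
    by_cases hv : v ∈ X
    · rcases eq_or_ne v x with rfl | hvx
      · rw [← hmass, hwu.mass, Finset.sum_eq_single_of_mem v hx h]
      · rw [h v hv hvx, hw0 v hv hvx]
    · rw [hu.eq_zero v hv, hw.eq_zero v (by rintro hvx; simp_all)]
  have hpos : 0 < ∑ v ∈ X, u v * Q (v - x) :=
    Finset.sum_pos' (fun v hv => mul_nonneg (hu.nonneg v) (hX.nonneg hv hx))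
      ⟨v, hv, mul_pos ((hu.nonneg v).lt_of_ne' huv) (hX v hv x hx hvx)⟩
  refine Or.inl ?_
  rw [heightFunctional_apply]
  simp only [Pi.sub_apply, sub_mul, Finset.sum_sub_distrib, hheight]
  simp only [two_smul, smul_eq_mul] at hvar
  linarith

theorem SpacelikePosition.isQDelaunayTriangulation_lexComplex (hd : 1 ≤ d)
    (hX : SpacelikePosition Q X) : IsQDelaunayTriangulation Q X (lexComplex X Q) where
  isTriangulationOf := {
    vertices_eq := by
      ext x
      exact ⟨fun h => Finset.singleton_subset_iff.1 (IsLexFace.subset h),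
        fun h => hX.isLexFace_singleton h⟩
    space_eq := space_lexComplex X Q }
  inscribed s hs := hX.exists_isEmptyCircumscribedQBall hd hs
  inscribed_unique s hs hcard := by
    obtain ⟨B, hB⟩ := hX.exists_isEmptyCircumscribedQBall hd hs
    refine ⟨B, hB, fun C hC => ?_⟩
    obtain ⟨φ, D, rfl, -, h⟩ := hB.exists_support
    obtain ⟨ψ, D', rfl, -, h'⟩ := hC.exists_support
    ext x
    simp only [Set.mem_ofPred_eq, eq_of_eqOn_of_card (IsLexFace.affineIndependent hs) hcard
      (fun x hx => (h x hx).trans (h' x hx).symm) x]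

/-- On the convex hull, the interpolant of a `Q`-Delaunay triangulation lies between `Q` and the
interpolant of any other triangulation. -/
theorem IsQDelaunayTriangulation.le_linearInterpolation_le
    {D T : Geometry.SimplicialComplex ℝ (EuclideanSpace ℝ (Fin d))}
    (hD : IsQDelaunayTriangulation Q X D) (hT : IsTriangulationOf X T)
    {y : EuclideanSpace ℝ (Fin d)} (hy : y ∈ convexHull ℝ (X : Set (EuclideanSpace ℝ (Fin d)))) :
    Q y ≤ linearInterpolation D Q y ∧ linearInterpolation D Q y ≤ linearInterpolation T Q y := by
  have hyD := hD.isTriangulationOf.space_eq ▸ hy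
  have hyT := hT.space_eq ▸ hy
  obtain ⟨s, hs, hys⟩ := D.mem_space_iff.1 hyD
  obtain ⟨t, ht, hyt⟩ := T.mem_space_iff.1 hyT
  obtain ⟨w, hw0, hw1, hwy⟩ := Finset.mem_convexHull'.1 hys
  obtain ⟨u, hu0, hu1, huy⟩ := Finset.mem_convexHull'.1 hyt
  obtain ⟨B, hB⟩ := hD.inscribed s hs
  obtain ⟨φ, C, rfl, hle, heq⟩ := hB.exists_support
  have htX : ∀ v ∈ t, v ∈ X := fun v hv => by
    rw [← Finset.mem_coe, ← hT.vertices_eq]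
    exact T.down_closed ht (Finset.singleton_subset_iff.2 hv) (Finset.singleton_nonempty v)
  -- Averaging an affine function over any barycentric representation of `y` returns its value at
  -- `y`, so both interpolants can be compared with the same support.
  have haff : ∀ {r : Finset (EuclideanSpace ℝ (Fin d))} {z : EuclideanSpace ℝ (Fin d) → ℝ},
      ∑ v ∈ r, z v = 1 → ∑ v ∈ r, z v • v = y → ∑ v ∈ r, z v * (φ v + C) = φ y + C := by
    intro r z h1 h2
    rw [← h2]
    simp [mul_add, Finset.sum_add_distrib, ← Finset.sum_mul, h1]
  have hDy : linearInterpolation D Q y = φ y + C := by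
    rw [linearInterpolation_eq D Q hs ⟨hw0, hw1, hwy⟩, ← haff hw1 hwy]
    exact Finset.sum_congr rfl fun v hv => by rw [heq v hv]
  rw [hDy]
  refine ⟨hB.simplex_subset hys, ?_⟩
  rw [linearInterpolation_eq T Q ht ⟨hu0, hu1, huy⟩, ← haff hu1 huy]
  exact Finset.sum_le_sum fun v hv => mul_le_mul_of_nonneg_left (hle v (htX v hv)) (hu0 v hv)

theorem IsQDelaunayTriangulation.interpolationError_le
    {D T : Geometry.SimplicialComplex ℝ (EuclideanSpace ℝ (Fin d))}
    (hD : IsQDelaunayTriangulation Q X D) (hT : IsTriangulationOf X T)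
    (μ : Measure (EuclideanSpace ℝ (Fin d))) (p : ℝ≥0∞) :
    interpolationError μ D Q p ≤ interpolationError μ T Q p := by
  rw [interpolationError, interpolationError, hD.isTriangulationOf.space_eq, hT.space_eq]
  refine eLpNorm_mono_ae ?_
  filter_upwards [ae_restrict_mem (X.finite_toSet.isCompact_convexHull ℝ).measurableSet] with y hy
  obtain ⟨h1, h2⟩ := hD.le_linearInterpolation_le hT hy
  rw [Real.norm_of_nonpos (by linarith), Real.norm_of_nonpos (by linarith)]
  linarith

end QBall

theorem mainTheorem8 {d : ℕ} (hd : 1 ≤ d) (Q : QuadraticForm ℝ (EuclideanSpace ℝ (Fin d)))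
    (X : Finset (EuclideanSpace ℝ (Fin d))) (hX : SpacelikePosition Q X)
    (μ : Measure (EuclideanSpace ℝ (Fin d))) [μ.IsAddHaarMeasure] :
    (∃ D, IsQDelaunayTriangulation Q X D) ∧
      ∀ D, IsQDelaunayTriangulation Q X D → ∀ p : ℝ≥0∞, 1 ≤ p →
        IsLeast {e | ∃ T, IsTriangulationOf X T ∧ e = interpolationError μ T Q p}
          (interpolationError μ D Q p) := by
  refine ⟨⟨_, hX.isQDelaunayTriangulation_lexComplex hd⟩, fun D hD p _ =>
    ⟨⟨D, hD.isTriangulationOf, rfl⟩, ?_⟩⟩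
  rintro _ ⟨T, hT, rfl⟩
  exact hD.interpolationError_le hT μ p
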